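/- The Aztec diamond $AD_n$ of order $n\ge 0$ is the graph whose vertices are the white squares of a $(2n+1)\times(2n+1)$ chessboard with black corners, two white squares being joined by an edge exactly when they are diagonally adjacent ($AD_0$ is the empty graph). Number the rows of the board $0,\dots,2n$ from north to south and its columns $0,\dots,2n$ from west to east. The edges of $AD_n$ are partitioned into $n^2$ four-cycles, namely those formed by the four white squares that share a side with a black square in an odd row and an odd column; the cycles around the black squares of board column $2k-1$ form the $k$-th column of cycles, $1\le k\le n$. Let $x_i,y_i,z_i,w_i$ $(i\ge 1)$ be elements of a commutative ring (for instance, independent variables). For $a\ge 1$ let $(AD_n;\,a\le i\le a+n-1)$ denote $AD_n$ with the following edge weights: in every cycle of the $k$-th column the northwestern, northeastern, southeastern and southwestern edges have the weights $x_i,y_i,w_i,z_i$, respectively, where $i=a+k-1$. The weight of a perfect matching is the product of the weights of its edges, and $M(AD_n;\,a\le i\le a+n-1)$ denotes the sum of the weights of all perfect matchings (so that $M=1$ for $n=0$). Then, for every $n\ge 2$, $$M(AD_n;1\le i\le n)\,M(AD_{n-2};2\le i\le n-1)=(x_1w_n+y_nz_1)\,M(AD_{n-1};1\le i\le n-1)\,M(AD_{n-1};2\le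 i\le n),$$ and, for every $n\ge 0$, $$M(AD_n;1\le i\le n)=\prod_{1\le i\le j\le n}(x_iw_j+z_iy_j).$$ -/

import Mathlib

/-- The sum of the weights of all perfect matchings of the finite graph `G` with edge weights `ω`,
the weight of a perfect matching being the product of the weights of its edges. -/
noncomputable def matchingSum {V R : Type*} [Finite V] [CommRing R]
    (G : SimpleGraph V) (ω : Sym2 V → R) : R :=
  ∑ P ∈ (Set.toFinite {P : G.Subgraph | P.IsPerfectMatching}).toFinset,
    ∏ e ∈ (Set.toFinite P.edgeSet).toFinset, ω e

namespace Aztec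

/-- The white squares of a `(2n+1) × (2n+1)` chessboard with black corners. The square
`(r, c)` lies in row `r`, counted from the north, and column `c`, counted from the west, both
starting with `0`; the corner `(0, 0)` is black, so the white squares are those with `r + c` odd. -/
abbrev Vertex (n : ℕ) : Type :=
  {p : Fin (2 * n + 1) × Fin (2 * n + 1) // Odd ((p.1 : ℕ) + (p.2 : ℕ))}

/-- The row of a white square. -/
def Vertex.row {n : ℕ} (p : Vertex n) : ℕ := p.1.1

/-- The column of a white square. -/
def Vertex.col {n : ℕ} (p : Vertex n) : ℕ := p.1.2

/-- The Aztec diamond of order `n`: white squares are joined when they are diagonally adjacent. -/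
def diamond (n : ℕ) : SimpleGraph (Vertex n) where
  Adj p q := (p.row + 1 = q.row ∨ q.row + 1 = p.row) ∧ (p.col + 1 = q.col ∨ q.col + 1 = p.col)
  symm := ⟨fun _ _ h => ⟨h.1.symm, h.2.symm⟩⟩
  loopless := ⟨fun p h => by rcases h.1 with h | h <;> omega⟩

variable {R : Type*} [CommRing R]

/-- The edges of the Aztec diamond are partitioned into `n * n` four-cycles, those around the black
squares `(r, c)` with `r` and `c` odd. Such a cycle has the northern and southern vertices
`(r - 1, c)`, `(r + 1, c)` (even row) and the western and eastern vertices
`(r, c - 1)`, `(r, c + 1)` (odd row). Here `p` is the northern or southern end of an edge of the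
cycle, `q` is its western or eastern end, and `i` is the index of the variables
given to the cycle: the northwestern, northeastern, southeastern and southwestern edges have
the weights `x i`, `y i`, `w i`, `z i`. -/
def sideWeight (x y z w : ℕ → R) {n : ℕ} (i : ℕ) (p q : Vertex n) : R :=
  if p.row < q.row then
    if q.col < p.col then x i else y i
  else
    if p.col < q.col then w i else z i

/-- The edge weights of `(AD_n; a ≤ i ≤ a + n - 1)`: the four-cycles in the `k`-th column
(`k = 1, …, n`), that is, those around the squares in column `2 * k - 1` of the board, get the
variables with index `a + k - 1`. Every edge has exactly one end in an even row. Pairs that are not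
edges never matter. -/
def weight (x y z w : ℕ → R) (n a : ℕ) : Sym2 (Vertex n) → R :=
  Sym2.lift ⟨fun p q =>
    if Even p.row ∧ Odd q.row then sideWeight x y z w (a + p.col / 2) p q
    else if Even q.row ∧ Odd p.row then sideWeight x y z w (a + q.col / 2) q p
    else 0, by
      intro p q
      by_cases hp : Even p.row <;> by_cases hq : Even q.row <;>
        simp [hp, hq, ← Nat.not_even_iff_odd]⟩

/-- `M(AD_n; a ≤ i ≤ a + n - 1)`, the sum of the weights of the perfect matchings of the Aztec
diamond of order `n` whose columns of four-cycles are weighted with the indices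
`a, a + 1, …, a + n - 1` from west to east. -/
noncomputable def M (x y z w : ℕ → R) (n a : ℕ) : R :=
  matchingSum (diamond n) (weight x y z w n a)

end Aztec

/-! The proof is urban renewal, carried out in all four-cycles (cells) at once. For a matching,
record in each cell the set of vertices that are matched inside that cell. Write Δ for the cell's
NW·SE + NE·SW, which is `x i * w i + y i * z i`. Complementing the recorded set and moving each
weight to the opposite edge changes the contribution of the cell only by a power of Δ
(`exists_cellSum_eq`). A vertex shared by two cells is still covered exactly once, while the
boundary vertices become uncovered. What remains is the diamond whose order is smaller by one, in
the middle of the same board.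

Since Δ is constant along a column, the powers combine, and counting vertices shows that each column
contributes exactly one Δ (`prod_cellSum_eq`). In the smaller diamond `x` and `z` keep their
indices, while `y` and `w` come from the next column (`M_succ`). Iteration yields the product
formula `M_eq_prod`: each renewal extracts the factors with `i = j`, and the shift produces those
with `i < j`. The condensation identity follows by comparing factors, without division, so it holds
in every commutative ring. -/

/-! ### Perfect matchings as sets of edge indices -/

open Classical in
/-- The sum over perfect matchings, with the edges of the graph indexed by a finite set `E` by means
of an incidence relation. -/
theorem matchingSum_eq_sum_powerset {V ι R : Type*} [Finite V] [CommRing R]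
    (G : SimpleGraph V) (ω : Sym2 V → R) (E : Finset ι) (inc : V → ι → Prop) (Ω : ι → R)
    (hE : ∀ i ∈ E, ∃ u v, G.Adj u v ∧ ω s(u, v) = Ω i ∧ ∀ t, inc t i ↔ t = u ∨ t = v)
    (hadj : ∀ u v, G.Adj u v → ∃ i ∈ E, inc u i ∧ inc v i)
    (hinj : ∀ i ∈ E, ∀ j ∈ E, (∀ t, inc t i ↔ inc t j) → i = j) :
    matchingSum G ω =
      ∑ F ∈ E.powerset with ∀ v, ∃! i, i ∈ F ∧ inc v i, ∏ i ∈ F, Ω i := by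
  classical
  have key : ∀ i ∈ E, ∀ u v, G.Adj u v → inc u i → inc v i →
      ω s(u, v) = Ω i ∧ ∀ t, inc t i ↔ t = u ∨ t = v := by
    intro i hi u v huv hu hv
    obtain ⟨a, b, hab, hω, h⟩ := hE i hi
    have hne := huv.ne
    rcases (h u).1 hu with rfl | rfl <;> rcases (h v).1 hv with rfl | rfl
    · exact absurd rfl hne
    · exact ⟨hω, h⟩
    · exact ⟨by rw [Sym2.eq_swap]; exact hω, fun t => by rw [h t, or_comm]⟩
    · exact absurd rfl hne
  have uniq : ∀ i ∈ E, ∀ j ∈ E, ∀ u v, G.Adj u v → inc u i → inc v i → inc u j → inc v j →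
      i = j := by
    intro i hi j hj u v huv h1 h2 h3 h4
    exact hinj i hi j hj fun t => by
      rw [(key i hi u v huv h1 h2).2 t, (key j hj u v huv h3 h4).2 t]
  unfold matchingSum
  refine Finset.sum_bij'
    (fun P _ => E.filter fun i => ∃ u v, P.Adj u v ∧ inc u i ∧ inc v i)
    (fun F _ =>
      { verts := Set.univ
        Adj := fun u v => G.Adj u v ∧ ∃ i ∈ F, inc u i ∧ inc v i
        adj_sub := fun h => h.1
        edge_vert := fun _ => Set.mem_univ _
        symm := ⟨fun u v h => ⟨h.1.symm, by
          obtain ⟨i, hi, h1, h2⟩ := h.2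
          exact ⟨i, hi, h2, h1⟩⟩⟩ }) ?_ ?_ ?_ ?_ ?_
  · intro P hP
    simp only [Set.Finite.mem_toFinset, Set.mem_ofPred_eq,
      SimpleGraph.Subgraph.isPerfectMatching_iff] at hP
    simp only [Finset.mem_filter, Finset.mem_powerset, Finset.filter_subset, true_and]
    intro v
    obtain ⟨u, hu, huniq⟩ := hP v
    obtain ⟨i, hi, h1, h2⟩ := hadj v u hu.adj_sub
    refine ⟨i, ⟨⟨hi, v, u, hu, h1, h2⟩, h1⟩, ?_⟩
    rintro j ⟨⟨hj, a, b, hab, ha, hb⟩, hvj⟩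
    rcases ((key j hj a b hab.adj_sub ha hb).2 v).1 hvj with rfl | rfl
    · obtain rfl := huniq _ hab
      exact uniq j hj i hi _ _ hab.adj_sub ha hb h1 h2
    · obtain rfl := huniq _ hab.symm
      exact uniq j hj i hi _ _ hab.adj_sub ha hb h2 h1
  · intro F hF
    simp only [Finset.mem_filter, Finset.mem_powerset] at hF
    simp only [Set.Finite.mem_toFinset, Set.mem_ofPred_eq,
      SimpleGraph.Subgraph.isPerfectMatching_iff]
    intro v
    obtain ⟨i, ⟨hi, hvi⟩, hu⟩ := hF.2 v
    obtain ⟨a, b, hab, -, h⟩ := hE i (hF.1 hi)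
    have main : ∀ c, G.Adj v c → inc c i → ∃! w, G.Adj v w ∧ ∃ i ∈ F, inc v i ∧ inc w i := by
      intro c hc hci
      refine ⟨c, ⟨hc, i, hi, hvi, hci⟩, ?_⟩
      rintro d ⟨hd, j, hj, hvj, hdj⟩
      obtain rfl := hu j ⟨hj, hvj⟩
      rcases ((key _ (hF.1 hj) v c hc hvj hci).2 d).1 hdj with rfl | rfl
      · exact absurd rfl hd.ne
      · rfl
    rcases (h v).1 hvi with rfl | rfl
    · exact main b hab ((h b).2 (Or.inr rfl))
    · exact main a hab.symm ((h a).2 (Or.inl rfl))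
  · intro P hP
    simp only [Set.Finite.mem_toFinset, Set.mem_ofPred_eq] at hP
    ext u v
    · simp [hP.2 u]
    · simp only [Finset.mem_filter]
      constructor
      · rintro ⟨huv, i, ⟨hi, a, b, hab, ha, hb⟩, hui, hvi⟩
        have h := (key i hi a b hab.adj_sub ha hb).2
        rcases (h u).1 hui with rfl | rfl <;> rcases (h v).1 hvi with rfl | rfl
        · exact absurd rfl huv.ne
        · exact hab
        · exact hab.symm
        · exact absurd rfl huv.ne
      · intro huv
        obtain ⟨i, hi, h1, h2⟩ := hadj u v huv.adj_sub
        exact ⟨huv.adj_sub, i, ⟨hi, u, v, huv, h1, h2⟩, h1, h2⟩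
  · intro F hF
    simp only [Finset.mem_filter, Finset.mem_powerset] at hF
    ext i
    simp only [Finset.mem_filter]
    constructor
    · rintro ⟨hi, u, v, ⟨huv, j, hj, huj, hvj⟩, hui, hvi⟩
      rwa [uniq i hi j (hF.1 hj) u v huv hui hvi huj hvj]
    · intro hi
      obtain ⟨a, b, hab, -, h⟩ := hE i (hF.1 hi)
      have ha := (h a).2 (Or.inl rfl)
      have hb := (h b).2 (Or.inr rfl)
      exact ⟨hF.1 hi, a, b, ⟨hab, i, hi, ha, hb⟩, ha, hb⟩
  · intro P hP
    have hsub : ∀ e ∈ (Set.toFinite P.edgeSet).toFinset, ∃ i ∈ E, ∃ u v, P.Adj u v ∧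
        e = s(u, v) ∧ inc u i ∧ inc v i := by
      intro e he
      induction e using Sym2.ind with
      | _ u v =>
        simp only [Set.Finite.mem_toFinset, SimpleGraph.Subgraph.mem_edgeSet] at he
        obtain ⟨i, hi, h1, h2⟩ := hadj u v he.adj_sub
        exact ⟨i, hi, u, v, he, rfl, h1, h2⟩
    choose f hfE fu fv hf hfe h1 h2 using hsub
    refine Finset.prod_bij f ?_ ?_ ?_ ?_
    · intro e he
      exact Finset.mem_filter.2 ⟨hfE e he, _, _, hf e he, h1 e he, h2 e he⟩
    · intro e he e' he' hee
      have k1 := (key _ (hfE e he) _ _ (hf e he).adj_sub (h1 e he) (h2 e he)).2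
      have k2 := (key _ (hfE e' he') _ _ (hf e' he').adj_sub (h1 e' he') (h2 e' he')).2
      apply Sym2.ext
      intro t
      rw [hfe e he, hfe e' he', Sym2.mem_iff, Sym2.mem_iff, ← k1, ← k2, hee]
    · intro i hi
      obtain ⟨hi, u, v, huv, hu, hv⟩ := Finset.mem_filter.1 hi
      have he : s(u, v) ∈ (Set.toFinite P.edgeSet).toFinset := by
        simpa using huv
      refine ⟨s(u, v), he, ?_⟩
      have hs := hfe _ he
      have g1 := h1 _ he
      have g2 := h2 _ he
      rcases Sym2.eq_iff.1 hs with ⟨ha, hb⟩ | ⟨ha, hb⟩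
      · rw [← ha] at g1
        rw [← hb] at g2
        exact uniq _ (hfE _ he) i hi u v huv.adj_sub g1 g2 hu hv
      · rw [← hb] at g1
        rw [← ha] at g2
        exact uniq _ (hfE _ he) i hi u v huv.adj_sub g2 g1 hu hv
    · intro e he
      conv_lhs => rw [hfe e he]
      exact (key _ (hfE e he) _ _ (hf e he).adj_sub (h1 e he) (h2 e he)).1

namespace Aztec

/-! ### Cells and the gluing of local matchings -/

/-- The cells of the Aztec diamond of order `m + 1`, by row and column. -/
abbrev Cell (m : ℕ) : Type := Fin (m + 1) × Fin (m + 1)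

/-- The four edges of a cell: the first component tells whether the edge is southern, the second
whether it is eastern. -/
abbrev Dir : Type := Bool × Bool

/-- A set of vertices of a cell: the first component tells which of the northern (`false`) and
southern (`true`) vertices belong to it, the second does this for the western and eastern ones. -/
abbrev Cover : Type := (Bool → Bool) × (Bool → Bool)

/-- The degree of the northern (`false`) or southern (`true`) vertex in a set of edges. -/
def vertDegree (q : Finset Dir) (s : Bool) : ℕ := (q.filter fun d => d.1 = s).card

/-- The degree of the western (`false`) or eastern (`true`) vertex in a set of edges. -/
def horDegree (q : Finset Dir) (e : Bool) : ℕ := (q.filter fun d => d.2 = e).card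

/-- The set of edges `q` of a cell is a perfect matching of the set of vertices `t`. -/
def Covers (q : Finset Dir) (t : Cover) : Prop :=
  (∀ s, vertDegree q s = (t.1 s).toNat) ∧ ∀ e, horDegree q e = (t.2 e).toNat

instance (q : Finset Dir) (t : Cover) : Decidable (Covers q t) := by
  unfold Covers; infer_instance

/-- The degrees along a row or column of cells add up to `1` at the vertices shared by two cells and
to `β` at the two ends. -/
def LineGlued {m : ℕ} (β : ℕ) (A : Fin (m + 1) → Bool → ℕ) : Prop :=
  A 0 false = β ∧ A (Fin.last m) true = β ∧
    ∀ i : Fin m, A i.castSucc true + A i.succ false = 1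

/-- The degrees in the cells add up to `1` at the interior vertices and to `β` on the boundary. -/
def Glued {m : ℕ} (β : ℕ) (A B : Cell m → Bool → ℕ) : Prop :=
  (∀ k, LineGlued β fun r => A (r, k)) ∧ ∀ r, LineGlued β fun k => B (r, k)

theorem LineGlued.le_one {m β : ℕ} (hβ : β ≤ 1) {A : Fin (m + 1) → Bool → ℕ}
    (h : LineGlued β A) (r : Fin (m + 1)) (s : Bool) : A r s ≤ 1 := by
  obtain ⟨h0, h1, h2⟩ := h
  cases s
  · induction r using Fin.cases with
    | zero => omega
    | succ i => have := h2 i; omega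
  · induction r using Fin.lastCases with
    | last => omega
    | cast i => have := h2 i; omega

/-- The sum of the weights of the perfect matchings of the set `t` of vertices of a cell. -/
def cellSum {R : Type*} [CommRing R] (u : Dir → R) (t : Cover) : R :=
  ∑ q : Finset Dir with Covers q t, ∏ d ∈ q, u d

-- Once the covered vertices of every cell are prescribed, the cells are independent and the sum
-- factors. The bound `β ≤ 1` forces all degrees to be 0 or 1, so Booleans record them faithfully.
open Classical in
theorem sum_glued_eq_sum_cover {R : Type*} [CommRing R] {m β : ℕ} (hβ : β ≤ 1)
    (u : Cell m → Dir → R) :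
    ∑ p : Cell m → Finset Dir with
        Glued β (fun γ => vertDegree (p γ)) (fun γ => horDegree (p γ)), ∏ γ, ∏ d ∈ p γ, u γ d =
      ∑ σ : Cell m → Cover with
        Glued β (fun γ s => ((σ γ).1 s).toNat) (fun γ e => ((σ γ).2 e).toNat),
        ∏ γ, cellSum (u γ) (σ γ) := by
  have hb : ∀ a : ℕ, a ≤ 1 → (decide (a = 1)).toNat = a := by
    intro a ha
    interval_cases a <;> rfl
  have hb' : ∀ b : Bool, decide (b.toNat = 1) = b := by decide
  have cov : ∀ p : Cell m → Finset Dir,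
      Glued β (fun γ => vertDegree (p γ)) (fun γ => horDegree (p γ)) → ∀ γ,
      Covers (p γ) (fun s => decide (vertDegree (p γ) s = 1),
        fun e => decide (horDegree (p γ) e = 1)) := fun p hp γ =>
    ⟨fun s => (hb _ ((hp.1 γ.2).le_one hβ γ.1 s)).symm,
      fun e => (hb _ ((hp.2 γ.1).le_one hβ γ.2 e)).symm⟩
  rw [← Finset.sum_fiberwise_of_maps_to
    (g := fun (p : Cell m → Finset Dir) γ =>
      ((fun s => decide (vertDegree (p γ) s = 1), fun e => decide (horDegree (p γ) e = 1)) : Cover))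
    (t := Finset.univ.filter fun σ : Cell m → Cover =>
        Glued β (fun γ s => ((σ γ).1 s).toNat) (fun γ e => ((σ γ).2 e).toNat))]
  · refine Finset.sum_congr rfl fun σ hσ => ?_
    simp only [cellSum]
    rw [Finset.prod_univ_sum]
    refine Finset.sum_congr ?_ fun _ _ => rfl
    ext p
    simp only [Finset.mem_filter, Finset.mem_univ, true_and, Fintype.mem_piFinset] at hσ ⊢
    constructor
    · rintro ⟨hp, rfl⟩ γ
      exact cov p hp γ
    · intro h
      have h1 : (fun γ => vertDegree (p γ)) = fun γ s => ((σ γ).1 s).toNat := by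
        funext γ s; exact (h γ).1 s
      have h2 : (fun γ => horDegree (p γ)) = fun γ e => ((σ γ).2 e).toNat := by
        funext γ s; exact (h γ).2 s
      refine ⟨by rwa [h1, h2], ?_⟩
      funext γ
      refine Prod.ext ?_ ?_
      · funext s
        simp only [(h γ).1 s, hb']
      · funext s
        simp only [(h γ).2 s, hb']
  · intro p hp
    simp only [Finset.mem_filter, Finset.mem_univ, true_and] at hp ⊢
    have h := cov p hp
    have h1 : (fun γ => vertDegree (p γ)) =
        fun γ s => (decide (vertDegree (p γ) s = 1)).toNat := by
      funext γ s; exact (h γ).1 s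
    have h2 : (fun γ => horDegree (p γ)) =
        fun γ s => (decide (horDegree (p γ) s = 1)).toNat := by
      funext γ s; exact (h γ).2 s
    rwa [← h1, ← h2]

/-! ### Urban renewal -/

/-- The perfect matchings of the sets of vertices of a cell. -/
def coverings (t : Cover) : Finset (Finset Dir) :=
  match t.1 false, t.1 true, t.2 false, t.2 true with
  | false, false, false, false => {∅}
  | true, false, true, false => {{(false, false)}}
  | true, false, false, true => {{(false, true)}}
  | false, true, true, false => {{(true, false)}}
  | false, true, false, true => {{(true, true)}}
  | true, true, true, true => {{(false, false), (true, true)}, {(false, true), (true, false)}}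
  | _, _, _, _ => ∅

theorem filter_covers (t : Cover) :
    (Finset.univ.filter fun q : Finset Dir => Covers q t) = coverings t := by
  revert t
  decide

/-- The complement of a set of vertices of a cell. -/
def Cover.compl (t : Cover) : Cover := (fun s => !t.1 s, fun e => !t.2 e)

/-- The edge opposite to an edge of a cell. -/
def Dir.opp (d : Dir) : Dir := (!d.1, !d.2)

/-- Urban renewal for one cell. -/
theorem exists_cellSum_eq {R : Type*} [CommRing R] (u : Dir → R) (t : Cover) :
    ∃ (h : R) (i j : ℕ),
      cellSum u t =
        (u (false, false) * u (true, true) + u (false, true) * u (true, false)) ^ i * h ∧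
      cellSum (fun d => u d.opp) t.compl =
        (u (false, false) * u (true, true) + u (false, true) * u (true, false)) ^ j * h ∧
      (h ≠ 0 → i + 1 = j + (t.1 false).toNat + (t.1 true).toNat) := by
  -- The two sums are 1 and Δ for the empty set, Δ and 1 for the full set, and the same single
  -- weight for the two ends of an edge, because the complement is matched by the opposite edge. In
  -- all other cases both vanish and `h = 0`.
  simp only [cellSum, filter_covers]
  simp only [coverings, Cover.compl]
  rcases t with ⟨v, g⟩
  dsimp only
  generalize v false = a
  generalize v true = b
  generalize g false = c
  generalize g true = d
  have h1 : ({(false, false), (true, true)} : Finset Dir) ≠ {(false, true), (true, false)} := by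
    decide
  have h2 (f : Dir → R) : ∏ d ∈ ({(false, false), (true, true)} : Finset Dir), f d =
      f (false, false) * f (true, true) := Finset.prod_pair (by decide)
  have h3 (f : Dir → R) : ∏ d ∈ ({(false, true), (true, false)} : Finset Dir), f d =
      f (false, true) * f (true, false) := Finset.prod_pair (by decide)
  rcases a <;> rcases b <;> rcases c <;> rcases d <;>
    simp only [Bool.not_true, Bool.not_false, Finset.sum_empty, Finset.sum_singleton,
      Finset.prod_empty, Finset.prod_singleton, Bool.toNat_false, Bool.toNat_true, Dir.opp,
      Finset.sum_pair h1, h2, h3]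
  · exact ⟨1, 0, 1, by ring, by ring, fun _ => rfl⟩
  all_goals first
    | exact ⟨0, 0, 0, (mul_zero _).symm, (mul_zero _).symm, fun h => absurd rfl h⟩
    | exact ⟨_, 0, 0, (one_mul _).symm.trans (by rw [pow_zero]),
        (one_mul _).symm.trans (by rw [pow_zero]), fun _ => rfl⟩
    | exact ⟨1, 1, 0, by ring, by ring, fun _ => rfl⟩

/-- The line has `m` shared vertices and two ends, each of total degree 1. -/
theorem LineGlued.sum_eq {m : ℕ} {A : Fin (m + 1) → Bool → ℕ} (h : LineGlued 1 A) :
    ∑ r, A r false + ∑ r, A r true = m + 2 := by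
  obtain ⟨h0, h1, h2⟩ := h
  rw [Fin.sum_univ_succ, Fin.sum_univ_castSucc (fun r => A r true), h0, h1]
  have : ∑ i : Fin m, A i.succ false + ∑ i : Fin m, A i.castSucc true = m := by
    rw [← Finset.sum_add_distrib, Finset.sum_congr rfl fun i _ => (add_comm _ _).trans (h2 i)]
    simp
  omega

/-- Urban renewal for a column of cells with equal weights. -/
theorem prod_cellSum_eq {R : Type*} [CommRing R] {m : ℕ} (u : Dir → R)
    (σ : Fin (m + 1) → Cover) (hσ : LineGlued 1 fun r s => ((σ r).1 s).toNat) :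
    ∏ r, cellSum u (σ r) =
      (u (false, false) * u (true, true) + u (false, true) * u (true, false)) *
        ∏ r, cellSum (fun d => u d.opp) (σ r).compl := by
  choose h i j h1 h2 h3 using fun r => exists_cellSum_eq u (σ r)
  simp only [h1, h2, Finset.prod_mul_distrib, Finset.prod_pow_eq_pow_sum]
  -- If some `h r` vanishes, the exponents are not controlled, but both products are zero.
  by_cases hz : ∃ r, h r = 0
  · obtain ⟨r, hr⟩ := hz
    rw [Finset.prod_eq_zero (Finset.mem_univ r) hr]
    simp
  · push Not at hz
    -- Summing `h3` over the `m + 1` cells gives `∑ i + (m + 1) = ∑ j + (m + 2)`: a column has one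
    -- more northern or southern vertex than it has cells.
    have e : ∑ r, i r = ∑ r, j r + 1 := by
      have := hσ.sum_eq
      have k := Finset.sum_congr (rfl : (Finset.univ : Finset (Fin (m + 1))) = _)
        fun r _ => h3 r (hz r)
      simp only [Finset.sum_add_distrib, Finset.sum_const, Finset.card_univ, Fintype.card_fin,
        smul_eq_mul, mul_one] at k
      omega
    rw [e, pow_succ]
    ring

/-- At a shared vertex complementation swaps which of the two cells covers it; at an end it turns 1
into 0. -/
theorem lineGlued_compl {m : ℕ} (a : Fin (m + 1) → Bool → Bool) :
    LineGlued 0 (fun r s => (!a r s).toNat) ↔ LineGlued 1 fun r s => (a r s).toNat := by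
  have h1 : ∀ b : Bool, (!b).toNat = 0 ↔ b.toNat = 1 := by decide
  have h2 : ∀ b c : Bool, (!b).toNat + (!c).toNat = 1 ↔ b.toNat + c.toNat = 1 := by decide
  simp only [LineGlued, h1, h2]

open Classical in
/-- Urban renewal: passing to opposite weights and complementary sets of vertices. -/
theorem sum_glued_one_eq {R : Type*} [CommRing R] {m : ℕ} (u : Fin (m + 1) → Dir → R) :
    ∑ p : Cell m → Finset Dir with
        Glued 1 (fun γ => vertDegree (p γ)) (fun γ => horDegree (p γ)),
        ∏ γ, ∏ d ∈ p γ, u γ.2 d =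
      (∏ k, (u k (false, false) * u k (true, true) + u k (false, true) * u k (true, false))) *
      ∑ p : Cell m → Finset Dir with
        Glued 0 (fun γ => vertDegree (p γ)) (fun γ => horDegree (p γ)),
        ∏ γ, ∏ d ∈ p γ, u γ.2 d.opp := by
  rw [sum_glued_eq_sum_cover le_rfl (fun γ => u γ.2),
    sum_glued_eq_sum_cover zero_le_one (fun γ d => u γ.2 d.opp), Finset.mul_sum]
  refine Finset.sum_nbij' (fun σ γ => (σ γ).compl) (fun σ γ => (σ γ).compl) ?_ ?_ ?_ ?_ ?_
  · intro σ hσ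
    simp only [Finset.mem_filter, Finset.mem_univ, true_and] at hσ ⊢
    exact ⟨fun k => (lineGlued_compl _).2 (hσ.1 k), fun r => (lineGlued_compl _).2 (hσ.2 r)⟩
  · intro σ hσ
    simp only [Finset.mem_filter, Finset.mem_univ, true_and] at hσ ⊢
    refine ⟨fun k => (lineGlued_compl _).1 ?_, fun r => (lineGlued_compl _).1 ?_⟩
    · simpa [Cover.compl] using hσ.1 k
    · simpa [Cover.compl] using hσ.2 r
  · intro σ _
    simp [Cover.compl]
  · intro σ _
    simp [Cover.compl]
  · intro σ hσ
    simp only [Finset.mem_filter, Finset.mem_univ, true_and] at hσ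
    -- The product is grouped by columns, since the weights, and hence Δ, are constant along each of
    -- them.
    rw [Fintype.prod_prod_type_right, Fintype.prod_prod_type_right, ← Finset.prod_mul_distrib]
    exact Finset.prod_congr rfl fun k _ => prod_cellSum_eq (u k) (fun r => σ (r, k)) (hσ.1 k)

/-! ### From gluing conditions to degrees at the squares of the board -/

/-- The edge `x.2` of the cell `x.1` ends at the square `(ρ, c)` of the board. -/
def Inc {m : ℕ} (ρ c : ℕ) (x : Cell m × Dir) : Prop :=
  ρ = 2 * x.1.1 + 2 * x.2.1.toNat ∧ c = 2 * x.1.2 + 1 ∨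
    ρ = 2 * x.1.1 + 1 ∧ c = 2 * x.1.2 + 2 * x.2.2.toNat

instance {m : ℕ} (ρ c : ℕ) (x : Cell m × Dir) : Decidable (Inc ρ c x) := by
  unfold Inc; infer_instance

/-- The degree of the square `(ρ, c)` in a set of edges given cell by cell. -/
def degree {m : ℕ} (p : Cell m → Finset Dir) (ρ c : ℕ) : ℕ :=
  ∑ γ, ((p γ).filter fun d => Inc ρ c (γ, d)).card

/-- The degree along a line of cells. -/
def lineDegree {m : ℕ} (A : Fin (m + 1) → Bool → ℕ) (ρ : ℕ) : ℕ :=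
  ∑ r : Fin (m + 1), ((if ρ = r then A r false else 0) + if ρ = r + 1 then A r true else 0)

theorem lineDegree_zero {m : ℕ} (A : Fin (m + 1) → Bool → ℕ) : lineDegree A 0 = A 0 false := by
  unfold lineDegree
  rw [Fintype.sum_eq_single 0]
  · simp
  · intro r hr
    have : (r : ℕ) ≠ 0 := fun h => hr (Fin.ext h)
    simp [this.symm]

theorem lineDegree_last {m : ℕ} (A : Fin (m + 1) → Bool → ℕ) :
    lineDegree A (m + 1) = A (Fin.last m) true := by
  unfold lineDegree
  rw [Fintype.sum_eq_single (Fin.last m)]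
  · simp
  · intro r hr
    have h1 : (r : ℕ) ≠ m := fun h => hr (Fin.ext h)
    have h2 := r.2
    rw [if_neg (by omega), if_neg (by omega), add_zero]

theorem lineDegree_succ {m : ℕ} (A : Fin (m + 1) → Bool → ℕ) (i : Fin m) :
    lineDegree A (i + 1) = A i.castSucc true + A i.succ false := by
  unfold lineDegree
  rw [Fintype.sum_eq_add i.castSucc i.succ (by simp [Fin.ext_iff])]
  · simp
  · intro r hr
    have h1 : (r : ℕ) ≠ i := fun h => hr.1 (Fin.ext h)
    have h2 : (r : ℕ) ≠ i + 1 := fun h => hr.2 (Fin.ext h)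
    rw [if_neg (by omega), if_neg (by omega), add_zero]

theorem lineGlued_iff {m β : ℕ} (A : Fin (m + 1) → Bool → ℕ) :
    LineGlued β A ↔
      ∀ ρ ≤ m + 1, lineDegree A ρ = if ρ = 0 ∨ ρ = m + 1 then β else 1 := by
  constructor
  · rintro ⟨h0, h1, h2⟩ ρ hρ
    split_ifs with h
    · rcases h with rfl | rfl
      · rw [lineDegree_zero, h0]
      · rw [lineDegree_last, h1]
    · obtain ⟨i, rfl⟩ : ∃ i : Fin m, ρ = i + 1 := ⟨⟨ρ - 1, by omega⟩, by simp; omega⟩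
      rw [lineDegree_succ, h2]
  · intro h
    refine ⟨?_, ?_, fun i => ?_⟩
    · rw [← lineDegree_zero A, h _ (by omega)]; simp
    · rw [← lineDegree_last A, h _ (by omega)]; simp
    · have := i.2
      rw [← lineDegree_succ, h _ (by omega), if_neg (by omega)]

theorem degree_vert {m : ℕ} (p : Cell m → Finset Dir) (ρ : ℕ) (k : Fin (m + 1)) :
    degree p (2 * ρ) (2 * k + 1) = lineDegree (fun r => vertDegree (p (r, k))) ρ := by
  unfold degree lineDegree
  rw [Fintype.sum_prod_type]
  refine Finset.sum_congr rfl fun r _ => ?_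
  rw [Fintype.sum_eq_single k]
  · have h : ∀ d : Dir, Inc (2 * ρ) (2 * k + 1) ((r, k), d) ↔
        (ρ = r ∧ d.1 = false ∨ ρ = r + 1 ∧ d.1 = true) := by
      rintro ⟨_ | _, e⟩ <;> simp only [Inc, Bool.toNat_false, Bool.toNat_true] <;> simp <;> omega
    simp only [h]
    by_cases h1 : ρ = r
    · subst h1
      simp [vertDegree]
    · by_cases h2 : ρ = r + 1
      · subst h2
        simp [vertDegree]
      · simp [h1, h2]
  · intro k' hk
    have : (k' : ℕ) ≠ k := fun h => hk (Fin.ext h)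
    rw [Finset.card_eq_zero, Finset.filter_eq_empty_iff]
    intro d _
    simp only [Inc]
    omega

theorem degree_hor {m : ℕ} (p : Cell m → Finset Dir) (r : Fin (m + 1)) (c : ℕ) :
    degree p (2 * r + 1) (2 * c) = lineDegree (fun k => horDegree (p (r, k))) c := by
  unfold degree lineDegree
  rw [Fintype.sum_prod_type_right]
  refine Finset.sum_congr rfl fun k _ => ?_
  rw [Fintype.sum_eq_single r]
  · have h : ∀ d : Dir, Inc (2 * r + 1) (2 * c) ((r, k), d) ↔
        (c = k ∧ d.2 = false ∨ c = k + 1 ∧ d.2 = true) := by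
      rintro ⟨s, _ | _⟩ <;> simp only [Inc, Bool.toNat_false, Bool.toNat_true] <;> simp <;> omega
    simp only [h]
    by_cases h1 : c = k
    · subst h1
      simp [horDegree]
    · by_cases h2 : c = k + 1
      · subst h2
        simp [horDegree]
      · simp [h1, h2]
  · intro r' hr
    have : (r' : ℕ) ≠ r := fun h => hr (Fin.ext h)
    rw [Finset.card_eq_zero, Finset.filter_eq_empty_iff]
    intro d _
    simp only [Inc]
    omega

/-- White squares in even rows are the northern and southern vertices of cells, those in odd rows
the western and eastern ones. Together the two families of line conditions thus prescribe the degree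
at every white square. -/
theorem glued_iff {m β : ℕ} (p : Cell m → Finset Dir) :
    Glued β (fun γ => vertDegree (p γ)) (fun γ => horDegree (p γ)) ↔
      ∀ ρ ≤ 2 * m + 2, ∀ c ≤ 2 * m + 2, Odd (ρ + c) → degree p ρ c =
        if (ρ = 0 ∨ ρ = 2 * m + 2) ∨ c = 0 ∨ c = 2 * m + 2 then β else 1 := by
  unfold Glued
  simp only [lineGlued_iff, ← degree_vert, ← degree_hor]
  constructor
  · rintro ⟨h1, h2⟩ ρ hρ c hc hodd
    rcases Nat.even_or_odd' ρ with ⟨ρ, rfl | rfl⟩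
    · obtain ⟨k, rfl⟩ : ∃ k, c = 2 * k + 1 := ⟨c / 2, by have := Nat.odd_iff.1 hodd; omega⟩
      rw [h1 ⟨k, by omega⟩ ρ (by omega)]
      exact if_congr (by omega) rfl rfl
    · obtain ⟨k, rfl⟩ : ∃ k, c = 2 * k := ⟨c / 2, by have := Nat.odd_iff.1 hodd; omega⟩
      rw [h2 ⟨ρ, by omega⟩ k (by omega)]
      exact if_congr (by omega) rfl rfl
  · intro h
    constructor
    · intro k ρ hρ
      have := k.2
      rw [h _ (by omega) _ (by omega) ⟨ρ + k, by ring⟩]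
      exact if_congr (by omega) rfl rfl
    · intro r c hc
      have := r.2
      rw [h _ (by omega) _ (by omega) ⟨r + c, by ring⟩]
      exact if_congr (by omega) rfl rfl

theorem card_filter_inc {m : ℕ} (F : Finset (Cell m × Dir)) (ρ c : ℕ) :
    (F.filter (Inc ρ c)).card =
      degree (fun γ => Finset.univ.filter fun d => (γ, d) ∈ F) ρ c := by
  simp only [degree, Finset.card_eq_sum_ones]
  refine Finset.sum_finset_product _ _ _ fun x => ?_
  simp

open Classical in
/-- Sums over sets of edges, cell by cell. -/
theorem sum_edgeSets_eq {R : Type*} [CommRing R] {m : ℕ} (C : (Cell m → Finset Dir) → Prop)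
    (Ω : Cell m × Dir → R) :
    ∑ F : Finset (Cell m × Dir) with C fun γ => Finset.univ.filter fun d => (γ, d) ∈ F,
      ∏ x ∈ F, Ω x =
    ∑ p : Cell m → Finset Dir with C p, ∏ γ, ∏ d ∈ p γ, Ω (γ, d) := by
  refine Finset.sum_nbij' (fun F γ => Finset.univ.filter fun d => (γ, d) ∈ F)
    (fun p => Finset.univ.filter fun x => x.2 ∈ p x.1) ?_ ?_ ?_ ?_ ?_
  · intro F hF
    simpa using hF
  · intro p hp
    simpa using hp
  · intro F _
    ext x
    simp
  · intro p _
    simp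
  · intro F _
    exact Finset.prod_finset_product _ _ _ fun x => by simp

/-! ### Diamonds of orders `m + 1` and `m` on one board -/

open Classical in
/-- The matchings of an Aztec diamond that is placed in the middle of the board of the diamond of
order `m + 1`, in terms of the cells of the latter. -/
theorem matchingSum_diamond {R : Type*} [CommRing R] {m n δ : ℕ} (hn : n + δ = m + 1) (hδ : δ ≤ 1)
    (ω : Sym2 (Vertex n) → R) (Ω : Cell m × Dir → R)
    (hΩ : ∀ (x : Cell m × Dir) (u v : Vertex n),
      u.row + δ = 2 * x.1.1 + 2 * x.2.1.toNat → u.col + δ = 2 * x.1.2 + 1 →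
      v.row + δ = 2 * x.1.1 + 1 → v.col + δ = 2 * x.1.2 + 2 * x.2.2.toNat → ω s(u, v) = Ω x) :
    matchingSum (diamond n) ω =
      ∑ p : Cell m → Finset Dir with
        Glued (1 - δ) (fun γ => vertDegree (p γ)) (fun γ => horDegree (p γ)),
        ∏ γ, ∏ d ∈ p γ, Ω (γ, d) := by
  have vext : ∀ u v : Vertex n, u = v ↔ u.row = v.row ∧ u.col = v.col := by
    intro u v
    rw [Subtype.ext_iff, Prod.ext_iff, Fin.ext_iff, Fin.ext_iff]
    rfl
  have vlt : ∀ v : Vertex n, v.row < 2 * n + 1 ∧ v.col < 2 * n + 1 ∧ (v.row + v.col) % 2 = 1 :=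
    fun v => ⟨v.1.1.2, v.1.2.2, Nat.odd_iff.1 v.2⟩
  have vex : ∀ ρ c, δ ≤ ρ → ρ ≤ δ + 2 * n → δ ≤ c → c ≤ δ + 2 * n → (ρ + c) % 2 = 1 →
      ∃ v : Vertex n, v.row + δ = ρ ∧ v.col + δ = c := by
    intro ρ c h1 h2 h3 h4 h5
    refine ⟨⟨(⟨ρ - δ, by omega⟩, ⟨c - δ, by omega⟩), Nat.odd_iff.2 ?_⟩, ?_, ?_⟩
    · simp only; omega
    · simp only [Vertex.row]; omega
    · simp only [Vertex.col]; omega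
  have hbool : ∀ b : Bool, b.toNat ≤ 1 := Bool.toNat_le
  -- These are the edges with both ends on the board of the diamond of order `n`, shifted by `δ`.
  -- Only the even coordinates need bounds: the odd ones lie between 1 and `2 * m + 1` anyway.
  set E : Finset (Cell m × Dir) := Finset.univ.filter fun x =>
    (δ ≤ 2 * (x.1.1 : ℕ) + 2 * x.2.1.toNat ∧ 2 * (x.1.1 : ℕ) + 2 * x.2.1.toNat ≤ δ + 2 * n) ∧
    (δ ≤ 2 * (x.1.2 : ℕ) + 2 * x.2.2.toNat ∧ 2 * (x.1.2 : ℕ) + 2 * x.2.2.toNat ≤ δ + 2 * n) with hE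
  have ends : ∀ x ∈ E, ∃ u v : Vertex n, (u.row + δ = 2 * x.1.1 + 2 * x.2.1.toNat ∧
      u.col + δ = 2 * x.1.2 + 1) ∧ v.row + δ = 2 * x.1.1 + 1 ∧
      v.col + δ = 2 * x.1.2 + 2 * x.2.2.toNat := by
    intro x hx
    simp only [hE, Finset.mem_filter, Finset.mem_univ, true_and] at hx
    have h1 := x.1.1.2
    have h2 := x.1.2.2
    obtain ⟨u, hu⟩ := vex (2 * x.1.1 + 2 * x.2.1.toNat) (2 * x.1.2 + 1) (by omega) (by omega)
      (by omega) (by omega) (by omega)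
    obtain ⟨v, hv⟩ := vex (2 * x.1.1 + 1) (2 * x.1.2 + 2 * x.2.2.toNat) (by omega) (by omega)
      (by omega) (by omega) (by omega)
    exact ⟨u, v, hu, hv⟩
  rw [matchingSum_eq_sum_powerset (diamond n) ω E
    (fun v x => Inc (v.row + δ) (v.col + δ) x) Ω]
  · rw [← sum_edgeSets_eq
      (fun p => Glued (1 - δ) (fun γ => vertDegree (p γ)) (fun γ => horDegree (p γ)))]
    refine Finset.sum_congr ?_ fun _ _ => rfl
    ext F
    simp only [Finset.mem_filter, Finset.mem_powerset, Finset.mem_univ, true_and, glued_iff,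
      ← card_filter_inc]
    have hcard : ∀ ρ c, (F.filter (Inc ρ c)).card = 1 ↔ ∃! x, x ∈ F ∧ Inc ρ c x := by
      intro ρ c
      rw [Finset.card_eq_one, ExistsUnique]
      refine exists_congr fun x => ?_
      rw [Finset.eq_singleton_iff_unique_mem]
      simp only [Finset.mem_filter]
    constructor
    · rintro ⟨hF, h⟩ ρ hρ c hc hodd
      by_cases hin : (δ ≤ ρ ∧ ρ ≤ δ + 2 * n) ∧ δ ≤ c ∧ c ≤ δ + 2 * n
      · obtain ⟨v, rfl, rfl⟩ := vex ρ c hin.1.1 hin.1.2 hin.2.1 hin.2.2 (Nat.odd_iff.1 hodd)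
        rw [(hcard _ _).2 (h v)]
        split_ifs <;> omega
      -- A square outside the smaller board exists only for `δ = 1` and lies on the boundary of the
      -- large one.
      · rw [if_pos (by omega), show 1 - δ = 0 by omega, Finset.card_eq_zero,
          Finset.filter_eq_empty_iff]
        intro x hx hinc
        obtain ⟨u, v, hu, hv⟩ := ends x (hF hx)
        have := vlt u
        have := vlt v
        unfold Inc at hinc
        omega
    · intro h
      constructor
      · intro x hx
        simp only [hE, Finset.mem_filter, Finset.mem_univ, true_and]
        have h1 := x.1.1.2
        have h2 := x.1.2.2
        have h3 := hbool x.2.1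
        have h4 := hbool x.2.2
        -- An edge outside `E` forces `δ = 1` and has an end on the boundary, where the prescribed
        -- degree is 0.
        by_contra hcon
        have hempty : ∀ ρ c, Inc ρ c x → ρ ≤ 2 * m + 2 → c ≤ 2 * m + 2 → (ρ + c) % 2 = 1 →
            ¬(δ = 1 ∧ ((ρ = 0 ∨ ρ = 2 * m + 2) ∨ c = 0 ∨ c = 2 * m + 2)) := by
          rintro ρ c hinc hρ hc hodd ⟨h1, hb⟩
          have := h ρ hρ c hc (Nat.odd_iff.2 hodd)
          rw [if_pos hb, h1, Finset.card_eq_zero, Finset.filter_eq_empty_iff] at this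
          exact this hx hinc
        have k1 := hempty _ _ (Or.inl ⟨rfl, rfl⟩) (by omega) (by omega) (by omega)
        have k2 := hempty _ _ (Or.inr ⟨rfl, rfl⟩) (by omega) (by omega) (by omega)
        omega
      · intro v
        rw [← hcard]
        have := vlt v
        rw [h _ (by omega) _ (by omega) (Nat.odd_iff.2 (by omega))]
        split_ifs <;> omega
  · intro x hx
    obtain ⟨u, v, hu, hv⟩ := ends x hx
    refine ⟨u, v, ?_, hΩ x u v hu.1 hu.2 hv.1 hv.2, fun t => ?_⟩
    · have h3 := hbool x.2.1
      have h4 := hbool x.2.2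
      constructor <;> omega
    · rw [vext, vext]
      unfold Inc
      omega
  -- An odd shifted column marks the northern or southern end `u` of the edge; the row of `v` and
  -- the column of `u` then locate the cell.
  · have main : ∀ u v : Vertex n, (diamond n).Adj u v → (u.col + δ) % 2 = 1 →
        ∃ x ∈ E, Inc (u.row + δ) (u.col + δ) x ∧ Inc (v.row + δ) (v.col + δ) x := by
      intro u v huv hu
      obtain ⟨h1, h2⟩ := huv
      have := vlt u
      have := vlt v
      obtain ⟨s, hs⟩ : ∃ s : Bool, v.row + 2 * s.toNat = u.row + 1 := by
        rcases h1 with h1 | h1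
        · exact ⟨false, by simp; omega⟩
        · exact ⟨true, by simp; omega⟩
      obtain ⟨e, he⟩ : ∃ e : Bool, u.col + 2 * e.toNat = v.col + 1 := by
        rcases h2 with h2 | h2
        · exact ⟨true, by simp; omega⟩
        · exact ⟨false, by simp; omega⟩
      refine ⟨((⟨(v.row + δ) / 2, by omega⟩, ⟨(u.col + δ) / 2, by omega⟩), (s, e)), ?_, ?_, ?_⟩
      · simp only [hE, Finset.mem_filter, Finset.mem_univ, true_and]
        omega
      · left
        simp only
        omega
      · right
        simp only
        omega
    intro u v huv
    by_cases hu : (u.col + δ) % 2 = 1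
    · exact main u v huv hu
    · obtain ⟨x, hx, h1, h2⟩ := main v u huv.symm (by have := huv.2; omega)
      exact ⟨x, hx, h2, h1⟩
  · intro x hx y _ h
    obtain ⟨u, v, hu, hv⟩ := ends x hx
    have h1 := (h u).1 (Or.inl hu)
    have h2 := (h v).1 (Or.inr hv)
    unfold Inc at h1 h2
    have htoNat : ∀ b c : Bool, b.toNat = c.toNat → b = c := by decide
    have b1 := hbool x.2.1
    have b2 := hbool x.2.2
    have b3 := hbool y.2.1
    have b4 := hbool y.2.2
    refine Prod.ext (Prod.ext (Fin.ext ?_) (Fin.ext ?_)) (Prod.ext ?_ ?_)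
    · omega
    · omega
    · exact htoNat _ _ (by omega)
    · exact htoNat _ _ (by omega)

/-! ### The recursion for column weights and the product formula -/

variable {R : Type*} [CommRing R]

/-- The weights of the four edges of a cell with the variables of index `i`. -/
def edgeWeight (x y z w : ℕ → R) (i : ℕ) : Dir → R
  | (false, false) => x i
  | (false, true) => y i
  | (true, false) => z i
  | (true, true) => w i

theorem weight_of_even (x y z w : ℕ → R) {n : ℕ} (a : ℕ) (p q : Vertex n)
    (hp : p.row % 2 = 0) (hq : q.row % 2 = 1) :
    weight x y z w n a s(p, q) = sideWeight x y z w (a + p.col / 2) p q := by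
  simp [weight, Nat.even_iff, Nat.odd_iff, hp, hq]

theorem weight_of_odd (x y z w : ℕ → R) {n : ℕ} (a : ℕ) (p q : Vertex n)
    (hp : p.row % 2 = 1) (hq : q.row % 2 = 0) :
    weight x y z w n a s(p, q) = sideWeight x y z w (a + q.col / 2) q p := by
  simp [weight, Nat.even_iff, Nat.odd_iff, hp, hq]

/-- Urban renewal for Aztec diamonds with weights that depend on the column only. -/
theorem M_succ (x y z w : ℕ → R) (m a : ℕ) :
    M x y z w (m + 1) a = (∏ k ∈ Finset.range (m + 1),
        (x (a + k) * w (a + k) + y (a + k) * z (a + k))) *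
      M x (fun i => y (i + 1)) z (fun i => w (i + 1)) m a := by
  unfold M
  rw [matchingSum_diamond (m := m) (δ := 0) rfl zero_le_one _
      (fun e => edgeWeight x y z w (a + e.1.2) e.2),
    matchingSum_diamond (m := m) (δ := 1) rfl le_rfl _
      (fun e => edgeWeight x y z w (a + e.1.2) e.2.opp),
    sum_glued_one_eq (fun k => edgeWeight x y z w (a + k)),
    Finset.prod_range fun k => x (a + k) * w (a + k) + y (a + k) * z (a + k)]
  · rfl
  -- The shift by `δ = 1` swaps the row parities. An edge of a large cell is the opposite edge of a
  -- small cell, which matches `opp`. The eastern edges of a small cell lie in the next column of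
  -- large cells, whence the index shift in `y` and `w`.
  · rintro ⟨⟨r, k⟩, s, e⟩ u v h1 h2 h3 h4
    simp only at h1 h2 h3 h4
    rw [weight_of_odd _ _ _ _ _ _ _ (by omega) (by omega)]
    unfold sideWeight
    cases s <;> cases e <;> simp only [Bool.toNat_false, Bool.toNat_true] at h1 h4
    · rw [if_neg (by omega), if_pos (by omega)]
      exact congrArg w (by dsimp only; omega)
    · rw [if_neg (by omega), if_neg (by omega)]
      exact congrArg z (by dsimp only; omega)
    · rw [if_pos (by omega), if_neg (by omega)]
      exact congrArg y (by dsimp only; omega)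
    · rw [if_pos (by omega), if_pos (by omega)]
      exact congrArg x (by dsimp only; omega)
  · rintro ⟨⟨r, k⟩, s, e⟩ u v h1 h2 h3 h4
    simp only at h1 h2 h3 h4
    rw [weight_of_even _ _ _ _ _ _ _ (by omega) (by omega)]
    unfold sideWeight
    cases s <;> cases e <;> simp only [Bool.toNat_false, Bool.toNat_true] at h1 h4
    · rw [if_pos (by omega), if_pos (by omega)]
      exact congrArg x (by dsimp only; omega)
    · rw [if_pos (by omega), if_neg (by omega)]
      exact congrArg y (by dsimp only; omega)
    · rw [if_neg (by omega), if_neg (by omega)]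
      exact congrArg z (by dsimp only; omega)
    · rw [if_neg (by omega), if_pos (by omega)]
      exact congrArg w (by dsimp only; omega)

theorem M_zero (x y z w : ℕ → R) (a : ℕ) : M x y z w 0 a = 1 := by
  have hV : IsEmpty (Vertex 0) := ⟨fun v => by
    have h := v.2
    have h1 := v.1.1.2
    have h2 := v.1.2.2
    rw [Nat.odd_iff] at h
    omega⟩
  unfold M
  rw [matchingSum_eq_sum_powerset (diamond 0) _ (∅ : Finset ℕ) (fun _ _ => False) fun _ => 0]
  · simp
  · simp
  · exact fun u => isEmptyElim u
  · simp

/-- The product formula for Aztec diamonds with weights that depend on the column only. -/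
theorem M_eq_prod (x y z w : ℕ → R) (n a : ℕ) :
    M x y z w n a = ∏ j ∈ Finset.range n, ∏ i ∈ Finset.range (j + 1),
      (x (a + i) * w (a + j) + z (a + i) * y (a + j)) := by
  induction n generalizing y w with
  | zero => simp [M_zero]
  | succ m ih =>
    -- The factors with `i < j`: the product for `j = 0` is empty, and replacing `j` by `j + 1`
    -- gives the induction hypothesis for the shifted `y` and `w`.
    have hdiag : ∏ j ∈ Finset.range (m + 1), ∏ i ∈ Finset.range j,
        (x (a + i) * w (a + j) + z (a + i) * y (a + j)) =
        ∏ j ∈ Finset.range m, ∏ i ∈ Finset.range (j + 1),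
          (x (a + i) * w (a + j + 1) + z (a + i) * y (a + j + 1)) := by
      rw [Finset.prod_range_succ']
      simp [add_assoc]
    rw [M_succ, ih, ← hdiag, ← Finset.prod_mul_distrib]
    refine Finset.prod_congr rfl fun j _ => ?_
    rw [Finset.prod_range_succ _ j]
    ring

end Aztec

/-! ### Condensation and the product formula from index 1 -/

theorem mainTheorem8 {R : Type*} [CommRing R] (x y z w : ℕ → R) :
    (∀ n : ℕ, 2 ≤ n →
      Aztec.M x y z w n 1 * Aztec.M x y z w (n - 2) 2 =
        (x 1 * w n + y n * z 1) * (Aztec.M x y z w (n - 1) 1 * Aztec.M x y z w (n - 1) 2)) ∧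
    (∀ n : ℕ,
      Aztec.M x y z w n 1 =
        ∏ j ∈ Finset.Icc 1 n, ∏ i ∈ Finset.Icc 1 j, (x i * w j + z i * y j)) := by
  constructor
  · intro n hn
    obtain ⟨m, rfl⟩ := Nat.exists_eq_add_of_le' hn
    -- The factors with `j = n` are split into `i = 1` and `i ≥ 2`; by `h2` the latter are exactly
    -- what the order `n - 1` diamond starting at 2 has beyond that of order `n - 2`.
    have h1 : Aztec.M x y z w (m + 2) 1 = Aztec.M x y z w (m + 1) 1 *
        ((∏ i ∈ Finset.range (m + 1), (x (2 + i) * w (2 + m) + z (2 + i) * y (2 + m))) *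
          (x 1 * w (m + 2) + z 1 * y (m + 2))) := by
      rw [Aztec.M_eq_prod, Aztec.M_eq_prod, Finset.prod_range_succ,
        Finset.prod_range_succ'
          (fun i => x (1 + i) * w (1 + (m + 1)) + z (1 + i) * y (1 + (m + 1)))]
      refine congrArg₂ _ rfl (congrArg₂ _ (Finset.prod_congr rfl fun i _ => ?_) ?_)
      · rw [show 1 + (i + 1) = 2 + i by omega, show 1 + (m + 1) = 2 + m by omega]
      · rw [show 1 + (m + 1) = m + 2 by omega]
    have h2 : Aztec.M x y z w (m + 1) 2 = Aztec.M x y z w m 2 *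
        ∏ i ∈ Finset.range (m + 1), (x (2 + i) * w (2 + m) + z (2 + i) * y (2 + m)) := by
      rw [Aztec.M_eq_prod, Aztec.M_eq_prod, Finset.prod_range_succ]
    rw [show m + 2 - 2 = m by omega, show m + 2 - 1 = m + 1 by omega, h1, h2]
    ring
  · intro n
    have hI : ∀ (k : ℕ) (f : ℕ → R),
        ∏ i ∈ Finset.Icc 1 k, f i = ∏ i ∈ Finset.range k, f (1 + i) := by
      intro k f
      rw [Finset.range_eq_Ico, Finset.prod_Ico_add, ← Finset.Ico_add_one_right_eq_Icc]
    rw [Aztec.M_eq_prod, hI]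
    refine Finset.prod_congr rfl fun j _ => ?_
    rw [hI, add_comm 1 j]
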